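/- Let $V$ be a symplectic space of dimension $2n \ge 10$ over a field $\mathbb{K}$, that is, a $2n$-dimensional $\mathbb{K}$-vector space with a non-degenerate bilinear form $\Psi$ such that $\Psi(v,v)=0$ for all $v\in V$. Let $\mathcal{G}(V)$ be the graph whose vertices are the $2$-dimensional subspaces $S\le V$ such that $\Psi|_S$ is non-degenerate, two vertices $S,T$ being adjacent if and only if they are orthogonal, i.e. $\Psi(x,y)=0$ for all $x\in S$, $y\in T$. Let the frame complex $\mathcal{F}(V)$ be the clique complex of $\mathcal{G}(V)$, i.e. the simplicial complex whose simplices are the non-empty finite sets of pairwise orthogonal $2$-dimensional non-degenerate subspaces of $V$. Then $\mathcal{F}(V)$ is simply connected: its geometric realization is non-empty, path-connected and has trivial fundamental group. -/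

import Mathlib

noncomputable section

section Realization

variable {ι : Type*}

/-- The underlying set of the geometric realization of an abstract simplicial complex: a point is
a family of barycentric coordinates, that is a finitely supported function on the vertices with
nonnegative values and total sum `1`, whose support is a face. -/
@[ext]
structure GeometricRealization (X : AbstractSimplicialComplex ι) where
  coord : ι →₀ ℝ
  coord_nonneg : ∀ i, 0 ≤ coord i
  sum_coord : ∑ i ∈ coord.support, coord i = 1
  support_mem : coord.support ∈ X.faces

namespace GeometricRealization

variable {X : AbstractSimplicialComplex ι}

/-- The inclusion of the closed simplex spanned by a face `s` into the geometric realization: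
extend the barycentric coordinates by zero outside `s`. -/
def ofFace (s : X.faces) (x : stdSimplex ℝ {i // i ∈ (s : Finset ι)}) : GeometricRealization X where
  coord := Finsupp.embDomain (Function.Embedding.subtype (· ∈ (s : Finset ι)))
    (Finsupp.equivFunOnFinite.symm x.1)
  coord_nonneg i := by
    by_cases hi : i ∈ (s : Finset ι)
    · have h := Finsupp.embDomain_apply_self (Function.Embedding.subtype (· ∈ (s : Finset ι)))
        (Finsupp.equivFunOnFinite.symm x.1) ⟨i, hi⟩
      simp only [Function.Embedding.subtype_apply] at h
      rw [h]
      exact x.2.1 _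
    · rw [Finsupp.embDomain_of_notMem_range]
      rintro ⟨j, rfl⟩
      exact hi j.2
  sum_coord := by
    rw [Finsupp.support_embDomain, Finset.sum_map]
    simp only [Finsupp.embDomain_apply_self]
    refine Eq.trans ?_ x.2.2
    refine Finset.sum_subset (Finset.subset_univ _) fun i _ hi => ?_
    simpa using hi
  support_mem := by
    rw [Finsupp.support_embDomain]
    refine (X.isRelLowerSet_faces s.2).2 ?_ ?_
    · intro i hi
      obtain ⟨j, -, rfl⟩ := Finset.mem_map.1 hi
      exact j.2
    · rw [Finset.map_nonempty, Finset.nonempty_iff_ne_empty]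
      intro h
      have h1 : ∑ i, x.1 i = 0 := by
        refine Finset.sum_eq_zero fun i _ => ?_
        have : i ∉ (Finsupp.equivFunOnFinite.symm x.1).support := by
          rw [h]; exact Finset.notMem_empty i
        simpa using this
      exact zero_ne_one (h1.symm.trans x.2.2)

/-- The weak topology: the final topology with respect to the inclusions of all closed simplices
(each carrying its Euclidean topology). -/
instance : TopologicalSpace (GeometricRealization X) :=
  ⨆ s : X.faces, TopologicalSpace.coinduced (ofFace s) inferInstance

/-- A set is open in the geometric realization iff its trace on every closed simplex is open. -/
theorem isOpen_iff {U : Set (GeometricRealization X)} :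
    IsOpen U ↔ ∀ s : X.faces, IsOpen (ofFace s ⁻¹' U) := by
  refine isOpen_iSup_iff.trans (forall_congr' fun s => ?_)
  exact isOpen_coinduced

end GeometricRealization

end Realization

/-- The clique complex of a graph: the faces are the nonempty finite sets of pairwise adjacent
vertices. -/
def cliqueComplex {ι : Type*} (G : SimpleGraph ι) : AbstractSimplicialComplex ι where
  faces := {s | s.Nonempty ∧ G.IsClique (s : Set ι)}
  isRelLowerSet_faces := by
    intro s hs
    exact ⟨hs.1, fun t hts ht => ⟨ht, hs.2.subset (Finset.coe_subset.2 hts)⟩⟩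
  singleton_mem v := ⟨Finset.singleton_nonempty v, by simp⟩

section Symplectic

variable {K V : Type*} [Field K] [AddCommGroup V] [Module K V]

/-- The `2`-dimensional subspaces `S` of `V` such that the restriction of `Ψ` to `S` is
non-degenerate. -/
def NondegPlane (Ψ : LinearMap.BilinForm K V) : Type _ :=
  {S : Submodule K V // Module.finrank K S = 2 ∧ (Ψ.restrict S).Nondegenerate}

/-- The orthogonality graph of a space with an alternating form: its vertices are the
`2`-dimensional non-degenerate subspaces, and two of them are adjacent iff they are orthogonal. -/
def orthogonalityGraph (Ψ : LinearMap.BilinForm K V) (hΨ : Ψ.IsAlt) :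
    SimpleGraph (NondegPlane Ψ) where
  Adj S T := ∀ x ∈ S.1, ∀ y ∈ T.1, Ψ x y = 0
  symm := ⟨fun S T h y hy x hx => hΨ.isRefl x y (h x hx y hy)⟩
  loopless := ⟨by
    rintro ⟨S, hS, hnd⟩ h
    have h0 : ∀ x : S, x = 0 := fun x =>
      hnd.1 x fun y => h x.1 x.2 y.1 y.2
    have : Subsingleton S := ⟨fun a b => (h0 a).trans (h0 b).symm⟩
    rw [Module.finrank_zero_of_subsingleton] at hS
    exact absurd hS (by norm_num)⟩

/-- The frame complex: the clique complex of the orthogonality graph. -/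
def frameComplex (Ψ : LinearMap.BilinForm K V) (hΨ : Ψ.IsAlt) :
    AbstractSimplicialComplex (NondegPlane Ψ) :=
  cliqueComplex (orthogonalityGraph Ψ hΨ)

end Symplectic

end

/-! Paths in a clique complex are governed by its edges. Push a path into vertices through open
stars; its class is then a product of edge classes, and backtracks and triangles are trivial. So it
suffices to find a potential: classes `P v` of paths from a base vertex, compatible with every edge
(`simplyConnectedSpace_of_potential`).

Take for `P v` a two-edge path through a common neighbour. If any edge and any vertex have a common
neighbour and all squares commute, this works (`exists_potential`).

The geometry is one dimension count, `exists_nondegPlane_orthogonal`: a nondegenerate `N` costs only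
its dimension, any further subspace `U` costs twice its dimension. A square is subdivided along each
diagonal that is not an edge by a plane spanned by one vector from each of its ends, until both
pairs of opposite vertices meet. Such a square spans at most 4 + 2 dimensions, the first four being
nondegenerate; as 4 + 2·2 < 10, it has a common neighbour and is coned off. -/

noncomputable section

/-! ### Weak topology: continuity by coordinates and compact subsets. -/

namespace GeometricRealization

open Topology unitInterval CategoryTheory

variable {ι : Type*} {X : AbstractSimplicialComplex ι}

theorem coord_ofFace (s : X.faces) (x : stdSimplex ℝ {i // i ∈ (s : Finset ι)})
    (i : {i // i ∈ (s : Finset ι)}) : (ofFace s x).coord i = x.1 i := by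
  have h := Finsupp.embDomain_apply_self (Function.Embedding.subtype (· ∈ (s : Finset ι)))
    (Finsupp.equivFunOnFinite.symm x.1) i
  simp only [Function.Embedding.subtype_apply] at h
  exact h

theorem coord_ofFace_of_notMem (s : X.faces) (x : stdSimplex ℝ {i // i ∈ (s : Finset ι)})
    {i : ι} (hi : i ∉ (s : Finset ι)) : (ofFace s x).coord i = 0 := by
  refine Finsupp.embDomain_of_notMem_range _ _ _ ?_
  rintro ⟨j, rfl⟩
  exact hi j.2

theorem support_ofFace_subset (s : X.faces) (x : stdSimplex ℝ {i // i ∈ (s : Finset ι)}) :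
    (ofFace s x).coord.support ⊆ s := by
  intro i hi
  by_contra h
  exact Finsupp.mem_support_iff.1 hi (coord_ofFace_of_notMem s x h)

theorem ofFace_injective (s : X.faces) : Function.Injective (ofFace s) := by
  intro x y h
  ext i
  have := congrArg (fun z => z.coord i) h
  simp only [coord_ofFace] at this
  exact this

theorem exists_ofFace_eq (s : X.faces) (x : GeometricRealization X)
    (h : x.coord.support ⊆ s) : ∃ y, ofFace s y = x := by
  refine ⟨⟨fun i => x.coord i, fun i => x.coord_nonneg i, ?_⟩, ?_⟩
  · rw [Finset.sum_coe_sort (s : Finset ι) (fun i => x.coord i), ← x.sum_coord]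
    refine (Finset.sum_subset h fun i _ hi => ?_).symm
    simpa using hi
  · ext i
    by_cases hi : i ∈ (s : Finset ι)
    · exact coord_ofFace s _ ⟨i, hi⟩
    · rw [coord_ofFace_of_notMem s _ hi]
      exact (Finsupp.notMem_support_iff.1 fun h' => hi (h h')).symm

theorem isClosed_iff {C : Set (GeometricRealization X)} :
    IsClosed C ↔ ∀ s : X.faces, IsClosed (ofFace s ⁻¹' C) := by
  simp only [← isOpen_compl_iff, isOpen_iff, Set.preimage_compl]

theorem continuous_coord_ofFace (s : X.faces) (i : ι) :
    Continuous fun x => (ofFace s x).coord i := by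
  by_cases hi : i ∈ (s : Finset ι)
  · have : (fun x => (ofFace s x).coord i) = fun x => x.1 ⟨i, hi⟩ :=
      funext fun x => coord_ofFace s x ⟨i, hi⟩
    rw [this]
    exact (continuous_apply _).comp continuous_subtype_val
  · simpa only [coord_ofFace_of_notMem s _ hi] using continuous_const

theorem continuous_coord (i : ι) : Continuous fun x : GeometricRealization X => x.coord i :=
  continuous_def.2 fun _ hU => isOpen_iff.2 fun s => hU.preimage (continuous_coord_ofFace s i)

/-- A map into a geometric realization which meets only finitely many vertices is continuous as
soon as its barycentric coordinates are. -/
theorem continuous_of_coord {T : Type*} [TopologicalSpace T] {f : T → GeometricRealization X}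
    (S : Finset ι) (hS : ∀ t, (f t).coord.support ⊆ S)
    (hf : ∀ i, Continuous fun t => (f t).coord i) : Continuous f := by
  classical
  rw [continuous_iff_isClosed]
  intro C hC
  let c : GeometricRealization X → ι → ℝ := fun x i => x.coord i
  have hcf : Continuous fun t => c (f t) := continuous_pi hf
  let A : X.faces → Set (ι → ℝ) := fun s => (fun x => c (ofFace s x)) '' (ofFace s ⁻¹' C)
  have hA : ∀ s, IsClosed (A s) := fun s =>
    (((isClosed_iff.1 hC s).isCompact).image
      (continuous_pi fun i => continuous_coord_ofFace s i)).isClosed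
  have hfin : {s : X.faces | (s : Finset ι) ⊆ S}.Finite := by
    refine Set.Finite.of_finite_image (f := Subtype.val) ?_ Subtype.val_injective.injOn
    refine S.powerset.finite_toSet.subset ?_
    rintro _ ⟨s, hs, rfl⟩
    exact Finset.mem_coe.2 (Finset.mem_powerset.2 hs)
  -- Only the finitely many faces inside `S` matter. On each of them `C` is compact, so its image
  -- under the coordinates is closed in the product.
  have : f ⁻¹' C = ⋃ s ∈ {s : X.faces | (s : Finset ι) ⊆ S}, (fun t => c (f t)) ⁻¹' A s := by
    ext t
    simp only [Set.mem_preimage, Set.mem_iUnion, Set.mem_ofPred_eq, exists_prop]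
    constructor
    · intro ht
      refine ⟨⟨_, (f t).support_mem⟩, hS t, ?_⟩
      obtain ⟨y, hy⟩ := exists_ofFace_eq ⟨_, (f t).support_mem⟩ (f t) subset_rfl
      exact ⟨y, by simpa only [Set.mem_preimage, hy] using ht, by simp only [hy]⟩
    · rintro ⟨s, -, y, hy, h⟩
      have : ofFace s y = f t := by
        ext i
        exact congrFun h i
      rwa [← this]
  rw [this]
  exact hfin.isClosed_biUnion fun s _ => (hA s).preimage hcf

/-- A closed simplex has finitely many faces, hence contains finitely many points with distinct
supports. -/
theorem isClosed_of_injOn_support {D : Set (GeometricRealization X)}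
    (hD : D.InjOn fun x => x.coord.support) : IsClosed D := by
  classical
  refine isClosed_iff.2 fun s => Set.Finite.isClosed ?_
  refine Set.Finite.preimage (ofFace_injective s).injOn ?_ |>.subset
    (s := ofFace s ⁻¹' {x ∈ D | x.coord.support ⊆ s}) fun x hx => ⟨hx, support_ofFace_subset s x⟩
  refine Set.Finite.of_finite_image ?_ (hD.mono fun x hx => hx.1)
  refine (s : Finset ι).powerset.finite_toSet.subset ?_
  rintro _ ⟨x, hx, rfl⟩
  exact Finset.mem_coe.2 (Finset.mem_powerset.2 hx.2)

/-- A compact subset of a geometric realization meets only finitely many vertices. -/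
theorem exists_finset_of_isCompact {C : Set (GeometricRealization X)} (hC : IsCompact C) :
    ∃ S : Finset ι, ∀ x ∈ C, x.coord.support ⊆ S := by
  classical
  -- One point of `C` is chosen for each support. Every subset of `D` is closed, so `D` has no
  -- accumulation point, and compactness of `C` makes it finite.
  obtain ⟨D, hDC, hD⟩ := Set.SurjOn.exists_bijOn_subset
    (Set.surjOn_image (fun x : GeometricRealization X => x.coord.support) C)
  have hfin : D.Finite := by
    by_contra hinf
    obtain ⟨x, -, hx⟩ := Set.Infinite.exists_accPt_of_subset_isCompact hinf hC hDC
    have hcl : IsClosed (D \ {x}) := isClosed_of_injOn_support (hD.injOn.mono Set.sdiff_subset)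
    have := accPt_principal_iff_clusterPt.1 hx
    rw [← mem_closure_iff_clusterPt, hcl.closure_eq] at this
    exact this.2 rfl
  refine ⟨hfin.toFinset.biUnion fun x => x.coord.support, fun x hx => ?_⟩
  obtain ⟨y, hy, hxy⟩ := hD.surjOn ⟨x, hx, rfl⟩
  simp only at hxy
  rw [← hxy]
  exact Finset.subset_biUnion_of_mem (fun x : GeometricRealization X => x.coord.support)
    (hfin.mem_toFinset.2 hy)

theorem exists_finset_of_continuous {T : Type*} [TopologicalSpace T] [CompactSpace T]
    {f : T → GeometricRealization X} (hf : Continuous f) :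
    ∃ S : Finset ι, ∀ t, (f t).coord.support ⊆ S := by
  obtain ⟨S, hS⟩ := exists_finset_of_isCompact (isCompact_range hf)
  exact ⟨S, fun t => hS _ ⟨t, rfl⟩⟩

/-! ### Straight-line homotopies inside simplices and open stars. -/

theorem sum_coord_eq_sum (x : GeometricRealization X) : (x.coord.sum fun _ a => a) = 1 :=
  x.sum_coord

/-- Two points are joinable if they lie in a common closed simplex. -/
def Joinable (x y : GeometricRealization X) : Prop :=
  ∃ s ∈ X.faces, x.coord.support ⊆ s ∧ y.coord.support ⊆ s

theorem Joinable.refl (x : GeometricRealization X) : Joinable x x :=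
  ⟨_, x.support_mem, subset_rfl, subset_rfl⟩

/-- The point dividing the segment between two points of a common simplex in a given ratio. -/
def lerp (x y : GeometricRealization X) (h : Joinable x y) (t : I) : GeometricRealization X where
  coord := (1 - (t : ℝ)) • x.coord + (t : ℝ) • y.coord
  coord_nonneg i := by
    have h1 := x.coord_nonneg i
    have h2 := y.coord_nonneg i
    have h3 : 0 ≤ 1 - (t : ℝ) := sub_nonneg.2 t.2.2
    have h4 := t.2.1
    simp only [Finsupp.add_apply, Finsupp.smul_apply, smul_eq_mul]
    positivity
  sum_coord := by
    change (((1 - (t : ℝ)) • x.coord + (t : ℝ) • y.coord).sum fun _ a => a) = 1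
    rw [Finsupp.sum_add_index' (fun _ => rfl) (fun _ _ _ => rfl),
      Finsupp.sum_smul_index' (fun _ => rfl), Finsupp.sum_smul_index' (fun _ => rfl),
      ← Finsupp.smul_sum, ← Finsupp.smul_sum, sum_coord_eq_sum, sum_coord_eq_sum]
    simp
  support_mem := by
    classical
    obtain ⟨s, hs, hx, hy⟩ := h
    refine (X.isRelLowerSet_faces hs).2 ?_ ?_
    · exact Finsupp.support_add.trans (Finset.union_subset
        (Finsupp.support_smul.trans hx) (Finsupp.support_smul.trans hy))
    · rw [Finset.nonempty_iff_ne_empty, Ne, Finsupp.support_eq_empty]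
      intro h0
      have : (((1 - (t : ℝ)) • x.coord + (t : ℝ) • y.coord).sum fun _ a => a) = 1 := by
        rw [Finsupp.sum_add_index' (fun _ => rfl) (fun _ _ _ => rfl),
          Finsupp.sum_smul_index' (fun _ => rfl), Finsupp.sum_smul_index' (fun _ => rfl),
          ← Finsupp.smul_sum, ← Finsupp.smul_sum, sum_coord_eq_sum, sum_coord_eq_sum]
        simp
      rw [h0] at this
      simp at this

theorem coord_lerp {x y : GeometricRealization X} (h : Joinable x y) (t : I) (i : ι) :
    (lerp x y h t).coord i = (1 - (t : ℝ)) * x.coord i + (t : ℝ) * y.coord i := rfl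

theorem support_lerp_subset {x y : GeometricRealization X} (h : Joinable x y) (t : I)
    {s : Finset ι} (hx : x.coord.support ⊆ s) (hy : y.coord.support ⊆ s) :
    (lerp x y h t).coord.support ⊆ s := by
  classical
  exact Finsupp.support_add.trans (Finset.union_subset
        (Finsupp.support_smul.trans hx) (Finsupp.support_smul.trans hy))

@[simp]
theorem lerp_zero {x y : GeometricRealization X} (h : Joinable x y) : lerp x y h 0 = x := by
  ext i
  simp [coord_lerp]

@[simp]
theorem lerp_one {x y : GeometricRealization X} (h : Joinable x y) : lerp x y h 1 = y := by
  ext i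
  simp [coord_lerp]

@[simp]
theorem lerp_self {x : GeometricRealization X} (h : Joinable x x) (t : I) : lerp x x h t = x := by
  ext i
  rw [coord_lerp]
  ring

theorem continuous_lerp {T : Type*} [TopologicalSpace T] {f g : T → GeometricRealization X}
    {r : T → I} (hf : Continuous f) (hg : Continuous g) (hr : Continuous r)
    (S : Finset ι) (hfS : ∀ t, (f t).coord.support ⊆ S) (hgS : ∀ t, (g t).coord.support ⊆ S)
    (h : ∀ t, Joinable (f t) (g t)) : Continuous fun t => lerp (f t) (g t) (h t) (r t) := by
  refine continuous_of_coord S (fun t => support_lerp_subset _ _ (hfS t) (hgS t)) fun i => ?_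
  simp only [coord_lerp]
  have h1 := (continuous_coord i).comp hf
  have h2 := (continuous_coord i).comp hg
  have h3 : Continuous fun t => (r t : ℝ) := continuous_subtype_val.comp hr
  exact ((continuous_const.sub h3).mul h1).add (h3.mul h2)

/-- The straight path between two points of a common simplex. -/
def segment (x y : GeometricRealization X) (h : Joinable x y) : Path x y where
  toFun t := lerp x y h t
  continuous_toFun := by
    classical
    exact continuous_lerp continuous_const continuous_const continuous_id
      (x.coord.support ∪ y.coord.support) (fun _ => Finset.subset_union_left)
      (fun _ => Finset.subset_union_right) fun _ => h
  source' := lerp_zero h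
  target' := lerp_one h

theorem segment_apply {x y : GeometricRealization X} (h : Joinable x y) (t : I) :
    segment x y h t = lerp x y h t := rfl

theorem segment_self {x : GeometricRealization X} (h : Joinable x x) :
    segment x x h = Path.refl x := by
  ext t i
  rw [segment_apply, lerp_self, Path.refl_apply]

/-- Two paths which at each time are in a common simplex are homotopic. -/
theorem homotopic_of_joinable {x y : GeometricRealization X} (γ₀ γ₁ : Path x y)
    (h : ∀ t, Joinable (γ₀ t) (γ₁ t)) : γ₀.Homotopic γ₁ := by
  classical
  obtain ⟨S₀, hS₀⟩ := exists_finset_of_continuous γ₀.continuous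
  obtain ⟨S₁, hS₁⟩ := exists_finset_of_continuous γ₁.continuous
  exact ⟨{
    toFun := fun p => lerp (γ₀ p.2) (γ₁ p.2) (h p.2) p.1
    continuous_toFun := continuous_lerp (γ₀.continuous.comp continuous_snd)
      (γ₁.continuous.comp continuous_snd) continuous_fst (S₀ ∪ S₁)
      (fun t => (hS₀ _).trans Finset.subset_union_left)
      (fun t => (hS₁ _).trans Finset.subset_union_right) fun t => h t.2
    map_zero_left := fun t => lerp_zero _
    map_one_left := fun t => lerp_one _
    prop' := by
      intro t p hp
      ext i
      rcases hp with rfl | rfl <;> simp }⟩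

/-- The vertex of the geometric realization given by an element of the index type. -/
def vertex (X : AbstractSimplicialComplex ι) (v : ι) : GeometricRealization X where
  coord := Finsupp.single v 1
  coord_nonneg i := by
    classical
    rw [Finsupp.single_apply]
    split_ifs <;> norm_num
  sum_coord := by
    change ((Finsupp.single v (1 : ℝ)).sum fun _ a => a) = 1
    simp
  support_mem := by
    rw [Finsupp.support_single v one_ne_zero]
    exact X.singleton_mem v

theorem support_vertex (v : ι) : (vertex X v).coord.support = {v} :=
  Finsupp.support_single v one_ne_zero

theorem joinable_vertex {x : GeometricRealization X} {v : ι} (h : v ∈ x.coord.support) :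
    Joinable x (vertex X v) :=
  ⟨_, x.support_mem, subset_rfl, by rwa [support_vertex, Finset.singleton_subset_iff]⟩

theorem isOpen_star (v : ι) : IsOpen {x : GeometricRealization X | v ∈ x.coord.support} := by
  simp only [Finsupp.mem_support_iff]
  exact isOpen_ne_fun (continuous_coord v) continuous_const

theorem segment_trans_segment_homotopic {x y z : GeometricRealization X} {s : Finset ι}
    (hs : s ∈ X.faces) (hx : x.coord.support ⊆ s) (hy : y.coord.support ⊆ s)
    (hz : z.coord.support ⊆ s) (hxy : Joinable x y) (hyz : Joinable y z) (hxz : Joinable x z) :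
    ((segment x y hxy).trans (segment y z hyz)).Homotopic (segment x z hxz) := by
  refine homotopic_of_joinable _ _ fun t => ⟨s, hs, ?_, support_lerp_subset hxz _ hx hz⟩
  rw [Path.trans_apply]
  split_ifs
  · exact support_lerp_subset hxy _ hx hy
  · exact support_lerp_subset hyz _ hy hz

/-- A path inside the open star of a vertex, followed by the segment to the vertex, is homotopic to
the segment from its source to the vertex. -/
theorem trans_segment_vertex_homotopic {x y : GeometricRealization X} (γ : Path x y) (v : ι)
    (hγ : ∀ t, v ∈ (γ t).coord.support) (hx : Joinable x (vertex X v))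
    (hy : Joinable y (vertex X v)) :
    (γ.trans (segment y _ hy)).Homotopic (segment x _ hx) := by
  classical
  obtain ⟨S, hS⟩ := exists_finset_of_continuous γ.continuous
  -- `H` contracts the path linearly to `v`. The two boundary routes of the unit square from (0, 0)
  -- to (1, 1) are homotopic, and `H` is constant on the top edge.
  let H : C(I × I, GeometricRealization X) :=
    ⟨fun p => lerp (γ p.1) (vertex X v) (joinable_vertex (hγ p.1)) p.2,
      continuous_lerp (γ.continuous.comp continuous_fst) continuous_const continuous_snd
        (S ∪ {v}) (fun t => (hS _).trans Finset.subset_union_left)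
        (fun t => by simp [support_vertex]) fun p => joinable_vertex (hγ p.1)⟩
  have : ContractibleSpace I := Convex.contractibleSpace (convex_Icc 0 1) ⟨0, by simp⟩
  let id' : Path (0 : I) 1 := ⟨⟨id, continuous_id⟩, rfl, rfl⟩
  let bottom : Path ((0, 0) : I × I) (1, 0) := id'.prod (Path.refl 0)
  let right : Path ((1, 0) : I × I) (1, 1) := (Path.refl 1).prod id'
  let left : Path ((0, 0) : I × I) (0, 1) := (Path.refl 0).prod id'
  let top : Path ((0, 1) : I × I) (1, 1) := id'.prod (Path.refl 1)
  have key := (SimplyConnectedSpace.paths_homotopic (bottom.trans right)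
    (left.trans top)).map H
  have e1 : ((bottom.trans right).map H.continuous) =
      (γ.trans (segment y _ hy)).cast (by simp [H]) (by simp [H]) := by
    rw [Path.map_trans]
    ext t i
    simp only [Path.trans_apply, Path.cast_coe, Path.map_coe, Function.comp_apply]
    split_ifs
    · simp [bottom, H, id', Path.prod]
    · simp [right, H, id', Path.prod, segment_apply]
  have e2 : ((left.trans top).map H.continuous) =
      ((segment x _ hx).trans (Path.refl _)).cast (by simp [H]) (by simp [H]) := by
    rw [Path.map_trans]
    ext t i
    simp only [Path.trans_apply, Path.cast_coe, Path.map_coe, Function.comp_apply]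
    split_ifs
    · simp [left, H, id', Path.prod, segment_apply]
    · simp [top, H, id', Path.prod]
  rw [e1, e2] at key
  have h1 : H (0, 0) = x := by simp [H]
  have h2 : H (1, 1) = vertex X v := by simp [H]
  refine Path.Homotopic.trans ?_ ⟨Path.Homotopy.transRefl (segment x _ hx)⟩
  exact key.pathCast h1.symm h2.symm

end GeometricRealization

/-! ### Potentials in the fundamental groupoid. -/

section Potential

open Topology unitInterval CategoryTheory

variable {Y : Type*} [TopologicalSpace Y]

/-- The morphism of the fundamental groupoid given by a path. -/
def Path.toHom {x y : Y} (γ : Path x y) : FundamentalGroupoid.mk x ⟶ FundamentalGroupoid.mk y :=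
  FundamentalGroupoid.fromPath (Path.Homotopic.Quotient.mk γ)

theorem Path.toHom_eq_iff {x y : Y} {γ γ' : Path x y} : γ.toHom = γ'.toHom ↔ γ.Homotopic γ' :=
  FundamentalGroupoid.fromPath_eq_iff_homotopic γ γ'

theorem Path.toHom_trans {x y z : Y} (γ : Path x y) (γ' : Path y z) :
    (γ.trans γ').toHom = γ.toHom ≫ γ'.toHom := rfl

theorem Path.toHom_refl (x : Y) : (Path.refl x).toHom = 𝟙 _ := rfl

/-- If the morphisms `Q x` of the fundamental groupoid are compatible with all paths inside the
members of an open cover, then they are compatible with all paths. -/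
theorem comp_toHom_eq_of_cover {κ : Type*} {c : κ → Set Y} (hc : ∀ i, IsOpen (c i))
    (hcov : ∀ y, ∃ i, y ∈ c i) {x₀ : Y}
    (Q : ∀ x, FundamentalGroupoid.mk x₀ ⟶ FundamentalGroupoid.mk x)
    (hQ : ∀ (i : κ) (x y : Y) (γ : Path x y), (∀ t, γ t ∈ c i) → Q x ≫ γ.toHom = Q y)
    {x y : Y} (γ : Path x y) : Q x ≫ γ.toHom = Q y := by
  -- Lebesgue subdivision: each piece of the path lies in one member of the cover.
  obtain ⟨t, ht0, hmono, ⟨m, hm⟩, ht⟩ := exists_monotone_Icc_subset_open_cover_unitInterval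
    (c := fun i => γ ⁻¹' c i) (fun i => (hc i).preimage γ.continuous) fun s _ => by
      obtain ⟨i, hi⟩ := hcov (γ s)
      exact Set.mem_iUnion.2 ⟨i, hi⟩
  have key : ∀ k, Q (γ (t 0)) ≫ (γ.subpath (t 0) (t k)).toHom = Q (γ (t k)) := by
    intro k
    induction k with
    | zero => rw [Path.subpath_self, Path.toHom_refl, Category.comp_id]
    | succ k ih =>
      obtain ⟨i, hi⟩ := ht k
      have h1 : Q (γ (t k)) ≫ (γ.subpath (t k) (t (k + 1))).toHom = Q (γ (t (k + 1))) := by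
        refine hQ i _ _ _ fun s => ?_
        have : γ.subpath (t k) (t (k + 1)) s ∈ γ '' Set.Icc (t k) (t (k + 1)) := by
          rw [← Path.range_subpath_of_le γ _ _ (hmono k.le_succ)]
          exact ⟨s, rfl⟩
        obtain ⟨r, hr, hrs⟩ := this
        rw [← hrs]
        exact hi hr
      rw [← h1, ← ih, Category.assoc, ← Path.toHom_trans]
      congr 1
      exact (Path.toHom_eq_iff.2 ⟨Path.Homotopy.subpathTransSubpath γ _ _ _⟩).symm
  have h := key m
  rw [ht0, hm m le_rfl] at h
  clear key ht hm hmono ht0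
  -- This turns the endpoints into `γ 0` and `γ 1`, so that the types match those of the subpath.
  obtain ⟨γ, rfl, rfl⟩ := γ
  rw [Path.subpath_zero_one] at h
  exact h

/-- The `Q x` join every point to `x₀`. Parallel paths agree after composition with the invertible
`Q x`. -/
theorem simplyConnectedSpace_of_cover {κ : Type*} {c : κ → Set Y} (hc : ∀ i, IsOpen (c i))
    (hcov : ∀ y, ∃ i, y ∈ c i) {x₀ : Y}
    (Q : ∀ x, FundamentalGroupoid.mk x₀ ⟶ FundamentalGroupoid.mk x)
    (hQ : ∀ (i : κ) (x y : Y) (γ : Path x y), (∀ t, γ t ∈ c i) → Q x ≫ γ.toHom = Q y) :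
    SimplyConnectedSpace Y := by
  have hj : ∀ x, Joined x₀ x := fun x => ⟨Quotient.out (Q x)⟩
  refine simply_connected_iff_paths_homotopic'.2
    ⟨⟨⟨x₀⟩, fun x y => (hj x).symm.trans (hj y)⟩, fun {x y} p₁ p₂ => ?_⟩
  rw [← Path.toHom_eq_iff, ← cancel_epi (Q x), comp_toHom_eq_of_cover hc hcov Q hQ,
    comp_toHom_eq_of_cover hc hcov Q hQ]

/-- A geometric realization is simply connected if the edge groupoid of the complex has a
potential in the fundamental groupoid. -/
theorem GeometricRealization.simplyConnectedSpace_of_potential {ι : Type*}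
    {X : AbstractSimplicialComplex ι} (v₀ : ι)
    (P : ∀ v, FundamentalGroupoid.mk (vertex X v₀) ⟶ FundamentalGroupoid.mk (vertex X v))
    (hP : ∀ v w (h : Joinable (vertex X v) (vertex X w)), P v ≫ (segment _ _ h).toHom = P w) :
    SimplyConnectedSpace (GeometricRealization X) := by
  have hne : ∀ x : GeometricRealization X, ∃ v, v ∈ x.coord.support :=
    fun x => X.isRelLowerSet_faces x.support_mem |>.1
  choose f hf using hne
  -- The potential is extended from a chosen vertex of the support; `hQ` shows that the choice is
  -- immaterial.
  let Q : ∀ x, FundamentalGroupoid.mk (vertex X v₀) ⟶ FundamentalGroupoid.mk x :=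
    fun x => P (f x) ≫ inv (segment x _ (joinable_vertex (hf x))).toHom
  have hQ : ∀ (x : GeometricRealization X) (v) (hv : v ∈ x.coord.support),
      Q x ≫ (segment x _ (joinable_vertex hv)).toHom = P v := by
    intro x v hv
    have hj : ∀ w ∈ x.coord.support, (vertex X w).coord.support ⊆ x.coord.support := by
      intro w hw
      rwa [support_vertex, Finset.singleton_subset_iff]
    have h : Joinable (vertex X (f x)) (vertex X v) :=
      ⟨_, x.support_mem, hj _ (hf x), hj _ hv⟩
    have h1 := Path.toHom_eq_iff.2 (segment_trans_segment_homotopic x.support_mem subset_rfl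
      (hj _ (hf x)) (hj _ hv) (joinable_vertex (hf x)) h (joinable_vertex hv))
    rw [← h1, Path.toHom_trans]
    simp only [Q, Category.assoc, IsIso.inv_hom_id_assoc]
    exact hP _ _ _
  refine simplyConnectedSpace_of_cover (c := fun v => {x | v ∈ x.coord.support})
    isOpen_star (fun x => ⟨f x, hf x⟩) Q fun v x y γ hγ => ?_
  have hx : v ∈ x.coord.support := by simpa using hγ 0
  have hy : v ∈ y.coord.support := by simpa using hγ 1
  have h1 := Path.toHom_eq_iff.2
    (trans_segment_vertex_homotopic γ v hγ (joinable_vertex hx) (joinable_vertex hy))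
  rw [← cancel_mono (segment y _ (joinable_vertex hy)).toHom, Category.assoc, ← Path.toHom_trans,
    h1, hQ x v hx, hQ y v hy]

end Potential

/-! ### Squares and potentials for flat families on a graph. -/

section EdgeGroupoid

open CategoryTheory

variable {ι C : Type*} [Groupoid C] (G : SimpleGraph ι) (obj : ι → C)
  (e : ∀ v w, G.Adj v w → (obj v ⟶ obj w))

/-- A family of morphisms along the edges of a graph is flat if it is trivial along backtracking
paths and along triangles. -/
structure SimpleGraph.IsFlat : Prop where
  backtrack : ∀ v w (h : G.Adj v w), e v w h ≫ e w v h.symm = 𝟙 _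
  triangle : ∀ u v w (h₁ : G.Adj u v) (h₂ : G.Adj v w) (h₃ : G.Adj u w),
    e u v h₁ ≫ e v w h₂ = e u w h₃

/-- The square `v a w b` of a graph commutes. -/
def SimpleGraph.SquareCommutes (v a w b : ι) : Prop :=
  ∀ (h₁ : G.Adj v a) (h₂ : G.Adj a w) (h₃ : G.Adj v b) (h₄ : G.Adj b w),
    e v a h₁ ≫ e a w h₂ = e v b h₃ ≫ e b w h₄

variable {G obj e}

namespace SimpleGraph.IsFlat

theorem backtrack_assoc (he : G.IsFlat obj e) {v w : ι} (h : G.Adj v w) {Z : C}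
    (f : obj v ⟶ Z) : e v w h ≫ e w v h.symm ≫ f = f := by
  rw [← Category.assoc, he.backtrack, Category.id_comp]

/-- The diagonal cuts the square into two triangles. -/
theorem square_of_adj (he : G.IsFlat obj e) {v a w b : ι} (h : G.Adj a b) :
    G.SquareCommutes obj e v a w b := fun h₁ h₂ h₃ h₄ => by
  rw [← he.triangle v a b h₁ h h₃, ← he.triangle a b w h h₄ h₂, Category.assoc]

theorem square_trans {v a w c b : ι} (hv : G.Adj v c) (hw : G.Adj c w)
    (h₁ : G.SquareCommutes obj e v a w c) (h₂ : G.SquareCommutes obj e v c w b) :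
    G.SquareCommutes obj e v a w b := fun ha ha' hb hb' =>
  (h₁ ha ha' hv hw).trans (h₂ hv hw hb hb')

theorem square_rotate (he : G.IsFlat obj e) {v a w b : ι} (h : G.SquareCommutes obj e v a w b) :
    G.SquareCommutes obj e a v b w := fun h₁ h₂ h₃ h₄ => by
  have := h h₁.symm h₃ h₂ h₄.symm
  calc e a v h₁ ≫ e v b h₂
      = e a v h₁ ≫ (e v b h₂ ≫ e b w h₄.symm) ≫ e w b h₄ := by
        rw [Category.assoc, he.backtrack, Category.comp_id]
    _ = e a w h₃ ≫ e w b h₄ := by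
        rw [← this, Category.assoc, he.backtrack_assoc h₁]

/-- The square is the base of a cone of four triangles with apex `c`. -/
theorem square_of_common (he : G.IsFlat obj e) {v a w b c : ι} (hv : G.Adj c v) (ha : G.Adj c a)
    (hw : G.Adj c w) (hb : G.Adj c b) : G.SquareCommutes obj e v a w b :=
  square_trans hv.symm hw (he.square_of_adj ha.symm) (he.square_of_adj hb)

/-- If all squares commute, and if each edge and each vertex have a common neighbour, then a flat
family of morphisms has a potential. -/
theorem exists_potential (he : G.IsFlat obj e)
    (hsq : ∀ v a w b, G.SquareCommutes obj e v a w b)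
    (hnb : ∀ v w, ∃ c, G.Adj v c ∧ G.Adj c w)
    (hedge : ∀ u v w, G.Adj v w → ∃ c, G.Adj u c ∧ G.Adj c v ∧ G.Adj c w) (u : ι) :
    ∃ P : ∀ v, obj u ⟶ obj v, ∀ v w (h : G.Adj v w), P v ≫ e v w h = P w := by
  choose c hc hc' using hnb u
  refine ⟨fun v => e u (c v) (hc v) ≫ e (c v) v (hc' v), fun v w h => ?_⟩
  -- The square `u, c v, v, x`, the triangle `x, v, w` and the square `u, x, w, c w` fill the region
  -- between the two chosen paths.
  obtain ⟨x, hu, hv, hw⟩ := hedge u v w h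
  beta_reduce
  rw [hsq _ _ _ _ (hc v) (hc' v) hu hv, Category.assoc, he.triangle x v w hv h hw]
  exact hsq _ _ _ _ hu hw (hc w) (hc' w)

end SimpleGraph.IsFlat

end EdgeGroupoid

/-! ### Nondegenerate planes. -/

section SymplecticGeometry

variable {K V : Type*} [Field K] [AddCommGroup V] [Module K V] {Ψ : LinearMap.BilinForm K V}

theorem finrank_span_pair_of_ne_zero (hΨ : Ψ.IsAlt) {x y : V} (h : Ψ x y ≠ 0) :
    Module.finrank K (Submodule.span K {x, y}) = 2 := by
  have hli : LinearIndependent K ![x, y] := by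
    refine LinearIndependent.pair_iff.2 fun a b hab => ?_
    have h1 : Ψ (a • x + b • y) y = 0 := by rw [hab]; simp
    have h2 : Ψ x (a • x + b • y) = 0 := by rw [hab]; simp
    simp only [map_add, map_smul, LinearMap.add_apply, LinearMap.smul_apply, hΨ x, hΨ y,
      smul_eq_mul, mul_zero, add_zero, zero_add, mul_eq_zero, h, or_false] at h1 h2
    exact ⟨h1, h2⟩
  have := finrank_span_eq_card hli
  rwa [Matrix.range_cons_cons_empty, Fintype.card_fin] at this

theorem nondegenerate_restrict_span_pair (hΨ : Ψ.IsAlt) {x y : V} (h : Ψ x y ≠ 0) :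
    (Ψ.restrict (Submodule.span K {x, y})).Nondegenerate := by
  refine LinearMap.BilinForm.nondegenerate_restrict_of_disjoint_orthogonal Ψ hΨ.isRefl ?_
  rw [Submodule.disjoint_def]
  intro z hz hz'
  obtain ⟨a, b, rfl⟩ := Submodule.mem_span_pair.1 hz
  have h1 : Ψ x (a • x + b • y) = 0 := hz' x (Submodule.subset_span (by simp))
  have h2 : Ψ y (a • x + b • y) = 0 := hz' y (Submodule.subset_span (by simp))
  have h' : Ψ y x ≠ 0 := fun h0 => h (hΨ.isRefl _ _ h0)
  simp only [map_add, map_smul, hΨ x, hΨ y, smul_eq_mul, mul_zero, add_zero, zero_add,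
    mul_eq_zero, h, h', or_false] at h1 h2
  simp [h1, h2]

namespace NondegPlane

/-- The plane spanned by two vectors that are not orthogonal. -/
def ofPair (hΨ : Ψ.IsAlt) {x y : V} (h : Ψ x y ≠ 0) : NondegPlane Ψ :=
  ⟨Submodule.span K {x, y}, finrank_span_pair_of_ne_zero hΨ h,
    nondegenerate_restrict_span_pair hΨ h⟩

/-- A vector of a nondegenerate plane orthogonal to the plane vanishes. -/
theorem eq_zero_of_forall (S : NondegPlane Ψ) {x : V} (hx : x ∈ S.1)
    (h : ∀ y ∈ S.1, Ψ y x = 0) : x = 0 := by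
  have := S.2.2.2 ⟨x, hx⟩ fun y => h y.1 y.2
  exact congrArg Subtype.val this

theorem disjoint_orthogonal (S : NondegPlane Ψ) : Disjoint S.1 (Ψ.orthogonal S.1) :=
  Submodule.disjoint_def.2 fun _ hx hx' => S.eq_zero_of_forall hx hx'

theorem disjoint_orthogonal_sup (hΨ : Ψ.IsAlt) {S T : NondegPlane Ψ}
    (h : (orthogonalityGraph Ψ hΨ).Adj S T) :
    Disjoint (S.1 ⊔ T.1) (Ψ.orthogonal (S.1 ⊔ T.1)) := by
  refine Submodule.disjoint_def.2 fun z hz hz' => ?_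
  obtain ⟨p, hp, q, hq, rfl⟩ := Submodule.mem_sup.1 hz
  have hp0 : p = 0 := S.eq_zero_of_forall hp fun y hy => by
    have : Ψ y (p + q) = 0 := hz' y (Submodule.mem_sup_left hy)
    rwa [map_add, h y hy q hq, add_zero] at this
  have hq0 : q = 0 := T.eq_zero_of_forall hq fun y hy => by
    have : Ψ y (p + q) = 0 := hz' y (Submodule.mem_sup_right hy)
    rwa [map_add, h.symm y hy p hp, zero_add] at this
  rw [hp0, hq0, add_zero]

theorem adj_ofPair (hΨ : Ψ.IsAlt) {x y : V} (h : Ψ x y ≠ 0) {S : NondegPlane Ψ}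
    (hx : ∀ z ∈ S.1, Ψ z x = 0) (hy : ∀ z ∈ S.1, Ψ z y = 0) :
    (orthogonalityGraph Ψ hΨ).Adj S (ofPair hΨ h) := by
  intro z hz w hw
  obtain ⟨a, b, rfl⟩ := Submodule.mem_span_pair.1 hw
  rw [map_add, map_smul, map_smul, hx z hz, hy z hz, smul_zero, smul_zero, add_zero]

/-- A plane meeting `S` adds at most one dimension to it; the count for squares depends on this
saving. -/
theorem le_sup_span_of_mem (hΨ : Ψ.IsAlt) {S : NondegPlane Ψ} {p q : V} (hp : p ∈ S.1)
    (h : Ψ p q ≠ 0) : (ofPair hΨ h).1 ≤ S.1 ⊔ Submodule.span K {q} := by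
  refine Submodule.span_le.2 ?_
  rintro z (rfl | rfl)
  · exact Submodule.mem_sup_left hp
  · exact Submodule.mem_sup_right (Submodule.mem_span_singleton_self _)

theorem le_sup_span_of_mem' (hΨ : Ψ.IsAlt) {T : NondegPlane Ψ} {p q : V} (hq : q ∈ T.1)
    (h : Ψ p q ≠ 0) : (ofPair hΨ h).1 ≤ T.1 ⊔ Submodule.span K {p} := by
  refine Submodule.span_le.2 ?_
  rintro z (rfl | rfl)
  · exact Submodule.mem_sup_right (Submodule.mem_span_singleton_self _)
  · exact Submodule.mem_sup_left hq

end NondegPlane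

/-! ### Dimension counts and commuting squares. -/

variable [FiniteDimensional K V]

/-- Given a nondegenerate subspace `N` and a subspace `U` of a symplectic space, there is a
nondegenerate plane orthogonal to both of them as soon as `dim N + 2 dim U < dim V`. -/
theorem exists_nondegPlane_orthogonal (hΨ : Ψ.IsAlt) (hnd : Ψ.Nondegenerate)
    (N U : Submodule K V) (hN : Disjoint N (Ψ.orthogonal N))
    (h : Module.finrank K N + 2 * Module.finrank K U < Module.finrank K V) :
    ∃ S : NondegPlane Ψ, ∀ x ∈ N ⊔ U, ∀ y ∈ S.1, Ψ x y = 0 := by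
  by_cases hW : ∃ x ∈ Ψ.orthogonal (N ⊔ U), ∃ y ∈ Ψ.orthogonal (N ⊔ U), Ψ x y ≠ 0
  · obtain ⟨x, hx, y, hy, hxy⟩ := hW
    refine ⟨NondegPlane.ofPair hΨ hxy, fun z hz w hw => ?_⟩
    obtain ⟨a, b, rfl⟩ := Submodule.mem_span_pair.1 hw
    exact Submodule.add_mem _ (Submodule.smul_mem _ _ hx) (Submodule.smul_mem _ _ hy) z hz
  -- Otherwise `(N ⊔ U)ᗮ` is totally isotropic, so it lies in its own orthogonal `N ⊔ U`. It meets
  -- `N` trivially, so its dimension is at most `dim U`, whereas it is at least `dim V - dim N - dim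
  -- U`.
  · push Not at hW
    exfalso
    have hle : Ψ.orthogonal (N ⊔ U) ≤ N ⊔ U := by
      intro y hy
      rw [← LinearMap.BilinForm.orthogonal_orthogonal hnd hΨ.isRefl (N ⊔ U)]
      exact fun x hx => hW x hx y hy
    have hdisj : Disjoint (Ψ.orthogonal (N ⊔ U)) N :=
      (hN.mono_right (LinearMap.BilinForm.orthogonal_le le_sup_left)).symm
    have h1 := Submodule.finrank_sup_add_finrank_inf_eq (Ψ.orthogonal (N ⊔ U)) N
    rw [hdisj.eq_bot, finrank_bot] at h1
    have h2 : Module.finrank K ↥(Ψ.orthogonal (N ⊔ U) ⊔ N) ≤ Module.finrank K ↥(N ⊔ U) :=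
      Submodule.finrank_mono (sup_le hle le_sup_left)
    have h3 := LinearMap.BilinForm.finrank_orthogonal hnd (N ⊔ U)
    have h4 := Submodule.finrank_add_le_finrank_add_finrank N U
    omega

open NondegPlane

theorem exists_adj_adj (hΨ : Ψ.IsAlt) (hnd : Ψ.Nondegenerate) (hdim : 10 ≤ Module.finrank K V)
    (S T : NondegPlane Ψ) :
    ∃ R, (orthogonalityGraph Ψ hΨ).Adj S R ∧ (orthogonalityGraph Ψ hΨ).Adj R T := by
  obtain ⟨R, hR⟩ := exists_nondegPlane_orthogonal hΨ hnd S.1 T.1 S.disjoint_orthogonal (by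
    have := S.2.1
    have := T.2.1
    omega)
  exact ⟨R, fun x hx => hR x (Submodule.mem_sup_left hx),
    SimpleGraph.Adj.symm fun x hx => hR x (Submodule.mem_sup_right hx)⟩

theorem finrank_sup_le_four (S T : NondegPlane Ψ) :
    Module.finrank K ↥(S.1 ⊔ T.1) ≤ 4 := by
  have := Submodule.finrank_add_le_finrank_add_finrank S.1 T.1
  have := S.2.1
  have := T.2.1
  omega

/-- The sum of an edge is nondegenerate, so the count is 4 + 2·2 < 10. -/
theorem exists_adj_adj_adj (hΨ : Ψ.IsAlt) (hnd : Ψ.Nondegenerate)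
    (hdim : 10 ≤ Module.finrank K V) (R S T : NondegPlane Ψ)
    (h : (orthogonalityGraph Ψ hΨ).Adj S T) :
    ∃ Q, (orthogonalityGraph Ψ hΨ).Adj R Q ∧ (orthogonalityGraph Ψ hΨ).Adj Q S ∧
      (orthogonalityGraph Ψ hΨ).Adj Q T := by
  obtain ⟨Q, hQ⟩ := exists_nondegPlane_orthogonal hΨ hnd (S.1 ⊔ T.1) R.1
    (disjoint_orthogonal_sup hΨ h) (by
    have := finrank_sup_le_four S T
    have := R.2.1
    omega)
  exact ⟨Q, fun x hx => hQ x (Submodule.mem_sup_right hx),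
    SimpleGraph.Adj.symm fun x hx => hQ x (Submodule.mem_sup_left (Submodule.mem_sup_left hx)),
    SimpleGraph.Adj.symm fun x hx => hQ x (Submodule.mem_sup_left (Submodule.mem_sup_right hx))⟩

/-- A square of the orthogonality graph whose opposite vertices meet nontrivially has a common
neighbour. -/
theorem exists_common_neighbour (hΨ : Ψ.IsAlt) (hnd : Ψ.Nondegenerate)
    (hdim : 10 ≤ Module.finrank K V) {v a w b : NondegPlane Ψ} {p q : V}
    (h : (orthogonalityGraph Ψ hΨ).Adj v a) (hw : w.1 ≤ v.1 ⊔ Submodule.span K {p})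
    (hb : b.1 ≤ a.1 ⊔ Submodule.span K {q}) :
    ∃ c, (orthogonalityGraph Ψ hΨ).Adj c v ∧ (orthogonalityGraph Ψ hΨ).Adj c a ∧
      (orthogonalityGraph Ψ hΨ).Adj c w ∧ (orthogonalityGraph Ψ hΨ).Adj c b := by
  -- Here `v ⊔ a` is nondegenerate of dimension at most 4, and `p`, `q` span at most 2 dimensions.
  obtain ⟨c, hc⟩ := exists_nondegPlane_orthogonal hΨ hnd (v.1 ⊔ a.1)
    (Submodule.span K {p} ⊔ Submodule.span K {q}) (disjoint_orthogonal_sup hΨ h) (by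
    have := finrank_sup_le_four v a
    have := Submodule.finrank_add_le_finrank_add_finrank (Submodule.span K {p})
      (Submodule.span K {q})
    have hs : ∀ x : V, Module.finrank K (Submodule.span K {x}) ≤ 1 := fun x =>
      (finrank_span_le_card {x}).trans (by simp)
    have := hs p
    have := hs q
    omega)
  have key : ∀ u : NondegPlane Ψ,
      u.1 ≤ v.1 ⊔ a.1 ⊔ (Submodule.span K {p} ⊔ Submodule.span K {q}) →
      (orthogonalityGraph Ψ hΨ).Adj c u :=
    fun u hu => SimpleGraph.Adj.symm fun x hx => hc x (hu hx)
  exact ⟨c, key v (le_sup_left.trans le_sup_left), key a (le_sup_right.trans le_sup_left),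
    key w (hw.trans (sup_le_sup le_sup_left le_sup_left)),
    key b (hb.trans (sup_le_sup le_sup_right le_sup_right))⟩

open CategoryTheory in
-- If two opposite vertices are not orthogonal, a plane spanned by a vector of each is adjacent to
-- the other two vertices and splits the square. Doing this for both diagonals leaves squares with a
-- common neighbour.
theorem squareCommutes_orthogonalityGraph (hΨ : Ψ.IsAlt) (hnd : Ψ.Nondegenerate)
    (hdim : 10 ≤ Module.finrank K V) {C : Type*} [Groupoid C] {obj : NondegPlane Ψ → C}
    {e : ∀ v w, (orthogonalityGraph Ψ hΨ).Adj v w → (obj v ⟶ obj w)}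
    (he : (orthogonalityGraph Ψ hΨ).IsFlat obj e) (v a w b : NondegPlane Ψ) :
    (orthogonalityGraph Ψ hΨ).SquareCommutes obj e v a w b := by
  let G := orthogonalityGraph Ψ hΨ
  have nadj : ∀ S T : NondegPlane Ψ, ¬ G.Adj S T → ∃ p ∈ S.1, ∃ q ∈ T.1, Ψ p q ≠ 0 := by
    intro S T h
    by_contra! h'
    exact h h'
  have symm : ∀ {v a w b}, G.SquareCommutes obj e v a w b → G.SquareCommutes obj e v b w a :=
    fun h h₁ h₂ h₃ h₄ => (h h₃ h₄ h₁ h₂).symm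
  -- both pairs of opposite vertices meet
  have step₁ : ∀ (v a w b : NondegPlane Ψ) (p q : V), w.1 ≤ v.1 ⊔ Submodule.span K {p} →
      b.1 ≤ a.1 ⊔ Submodule.span K {q} → G.SquareCommutes obj e v a w b := by
    intro v a w b p q hw hb h₁ h₂ h₃ h₄
    obtain ⟨c, h1, h2, h3, h4⟩ := exists_common_neighbour hΨ hnd hdim h₁ hw hb
    exact he.square_of_common h1 h2 h3 h4 h₁ h₂ h₃ h₄
  -- one pair of opposite vertices meets
  have step₂ : ∀ (v a w b : NondegPlane Ψ) (p : V), w.1 ≤ v.1 ⊔ Submodule.span K {p} →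
      G.SquareCommutes obj e v a w b := by
    intro v a w b p hw h₁ h₂ h₃ h₄
    by_cases hab : G.Adj a b
    · exact he.square_of_adj hab h₁ h₂ h₃ h₄
    obtain ⟨x, hx, y, hy, hxy⟩ := nadj a b hab
    -- Both `x` and `y` lie in planes orthogonal to `v` and `w`.
    have hv : G.Adj v (ofPair hΨ hxy) :=
      adj_ofPair hΨ hxy (fun z hz => h₁ z hz x hx) (fun z hz => h₃ z hz y hy)
    have hw' : G.Adj (ofPair hΨ hxy) w := SimpleGraph.Adj.symm <|
      adj_ofPair hΨ hxy (fun z hz => h₂.symm z hz x hx) (fun z hz => h₄.symm z hz y hy)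
    exact SimpleGraph.IsFlat.square_trans hv hw'
      (step₁ v a w _ p y hw (le_sup_span_of_mem hΨ hx hxy))
      (symm (step₁ v b w _ p x hw (le_sup_span_of_mem' hΨ hy hxy))) h₁ h₂ h₃ h₄
  intro h₁ h₂ h₃ h₄
  by_cases hvw : G.Adj v w
  · exact he.square_rotate (he.square_of_adj hvw) h₁ h₂ h₃ h₄
  obtain ⟨x, hx, y, hy, hxy⟩ := nadj v w hvw
  -- The same splitting along the other diagonal; rotating the square exchanges the roles of the two
  -- diagonals.
  have ha : G.Adj a (ofPair hΨ hxy) :=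
    adj_ofPair hΨ hxy (fun z hz => h₁.symm z hz x hx) (fun z hz => h₂ z hz y hy)
  have hb : G.Adj (ofPair hΨ hxy) b := SimpleGraph.Adj.symm <|
    adj_ofPair hΨ hxy (fun z hz => h₃.symm z hz x hx) (fun z hz => h₄ z hz y hy)
  exact he.square_rotate (SimpleGraph.IsFlat.square_trans ha hb
    (he.square_rotate (step₂ v a _ b y (le_sup_span_of_mem hΨ hx hxy)))
    (symm (he.square_rotate (step₂ w a _ b x (le_sup_span_of_mem' hΨ hy hxy))))) h₁ h₂ h₃ h₄

end SymplecticGeometry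

/-! ### Edge paths in clique complexes, and the conclusion. -/

section CliqueComplex

open GeometricRealization CategoryTheory

variable {ι : Type*} {G : SimpleGraph ι}

theorem mem_faces_cliqueComplex {s : Finset ι} :
    s ∈ (cliqueComplex G).faces ↔ s.Nonempty ∧ G.IsClique (s : Set ι) := Iff.rfl

theorem pair_mem_faces_cliqueComplex [DecidableEq ι] {v w : ι} (h : G.Adj v w) :
    {v, w} ∈ (cliqueComplex G).faces := by
  rw [mem_faces_cliqueComplex]
  refine ⟨Finset.insert_nonempty _ _, ?_⟩
  simp [SimpleGraph.isClique_insert, h]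

theorem triple_mem_faces_cliqueComplex [DecidableEq ι] {u v w : ι} (h₁ : G.Adj u v)
    (h₂ : G.Adj v w) (h₃ : G.Adj u w) : {u, v, w} ∈ (cliqueComplex G).faces := by
  rw [mem_faces_cliqueComplex]
  refine ⟨Finset.insert_nonempty _ _, ?_⟩
  simp [SimpleGraph.isClique_insert, h₁, h₂, h₃]

theorem joinable_vertex_of_adj {v w : ι} (h : G.Adj v w) :
    Joinable (vertex (cliqueComplex G) v) (vertex (cliqueComplex G) w) := by
  classical
  exact ⟨_, pair_mem_faces_cliqueComplex h, by simp [support_vertex], by simp [support_vertex]⟩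

theorem eq_or_adj_of_joinable_vertex {v w : ι}
    (h : Joinable (vertex (cliqueComplex G) v) (vertex (cliqueComplex G) w)) :
    v = w ∨ G.Adj v w := by
  obtain ⟨s, hs, hv, hw⟩ := h
  rw [support_vertex, Finset.singleton_subset_iff] at hv hw
  exact or_iff_not_imp_left.2 fun hne => hs.2 hv hw hne

/-- The segments along the edges of a graph form a flat family in the fundamental groupoid of the
clique complex. -/
theorem isFlat_segment (G : SimpleGraph ι) :
    G.IsFlat (fun v => FundamentalGroupoid.mk (vertex (cliqueComplex G) v))
      (fun _ _ h => (segment _ _ (joinable_vertex_of_adj h)).toHom) := by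
  classical
  constructor
  · intro v w h
    rw [← Path.toHom_trans, ← Path.toHom_refl, Path.toHom_eq_iff, ← segment_self (Joinable.refl _)]
    refine segment_trans_segment_homotopic (pair_mem_faces_cliqueComplex h) ?_ ?_ ?_ _ _ _
    all_goals simp [support_vertex]
  · intro u v w h₁ h₂ h₃
    rw [← Path.toHom_trans, Path.toHom_eq_iff]
    refine segment_trans_segment_homotopic (triple_mem_faces_cliqueComplex h₁ h₂ h₃) ?_ ?_ ?_ _ _ _
    all_goals simp [support_vertex]

/-- The clique complex of a graph is simply connected if the segments along the edges have a
potential in its fundamental groupoid. -/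
theorem simplyConnectedSpace_cliqueComplex (v₀ : ι)
    (P : ∀ v, FundamentalGroupoid.mk (vertex (cliqueComplex G) v₀) ⟶
      FundamentalGroupoid.mk (vertex (cliqueComplex G) v))
    (hP : ∀ v w (h : G.Adj v w), P v ≫ (segment _ _ (joinable_vertex_of_adj h)).toHom = P w) :
    SimplyConnectedSpace (GeometricRealization (cliqueComplex G)) := by
  refine simplyConnectedSpace_of_potential v₀ P fun v w h => ?_
  rcases eq_or_adj_of_joinable_vertex h with rfl | h'
  · rw [segment_self, Path.toHom_refl, Category.comp_id]
  · exact hP v w h'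

end CliqueComplex

theorem theorem7p3 {K V : Type*} [Field K] [AddCommGroup V] [Module K V]
    (Ψ : LinearMap.BilinForm K V) (hΨ : Ψ.IsAlt) (hnd : Ψ.Nondegenerate)
    (n : ℕ) (hdim : Module.finrank K V = 2 * n) (hn : 10 ≤ 2 * n) :
    SimplyConnectedSpace (GeometricRealization (frameComplex Ψ hΨ)) := by
  have : FiniteDimensional K V := Module.finite_of_finrank_pos (by omega)
  have hdim' : 10 ≤ Module.finrank K V := by omega
  -- With `N = U = 0` the count only asks for `0 < dim V`; this gives the base vertex.
  obtain ⟨v₀, -⟩ := exists_nondegPlane_orthogonal hΨ hnd ⊥ ⊥ disjoint_bot_left (by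
    rw [finrank_bot]
    omega)
  have hflat := isFlat_segment (orthogonalityGraph Ψ hΨ)
  obtain ⟨P, hP⟩ := hflat.exists_potential (squareCommutes_orthogonalityGraph hΨ hnd hdim' hflat)
    (exists_adj_adj hΨ hnd hdim') (exists_adj_adj_adj hΨ hnd hdim') v₀
  exact simplyConnectedSpace_cliqueComplex v₀ P hP

end
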